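/- Let $\mathcal{P}$ be a directed graph with a unique source vertex $\mathbf{0}$ (a vertex with no incoming edges), in which every vertex has finite out-degree and such that there is a finite directed path from $\mathbf{0}$ to every vertex. Write $\lambda\to\nu$ if there is an edge from $\lambda$ to $\nu$. A function $\varphi:\mathcal{P}\to\mathbb{R}_{\ge 0}$ is called harmonic if $\varphi(\mathbf{0})=1$ and $\varphi(\lambda)=\sum_{\nu:\,\lambda\to\nu}\varphi(\nu)$ for all $\lambda\in\mathcal{P}$. Let $H(\mathcal{P})$ be the convex set of harmonic functions and let $\partial H(\mathcal{P})$ be its set of extreme points, that is, the $\varphi\in H(\mathcal{P})$ that cannot be written as $c\varphi_1+(1-c)\varphi_2$ with $0<c<1$ and $\varphi_1\neq\varphi_2$ in $H(\mathcal{P})$. Let $A$ be an associative unital $\mathbb{R}$-algebra with a basis $\{a_\lambda:\lambda\in\mathcal{P}\}$ such that (P1) $a_{\mathbf{0}}=1$, and for all $\lambda,\mu\in\mathcal{P}$ the product $a_\lambda a_\mu$ lies in $A_+$, the set of linear combinations of the $a_\nu$ $(\nu\in\mathcal{P})$ with nonnegative real coefficients; (P2) there is an index $\mathbf{1}\in\mathcal{P}$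 with $a_{\mathbf{1}}a_\lambda=\sum_{\nu:\,\lambda\to\nu}a_\nu$ for all $\lambda\in\mathcal{P}$. Let $\varphi:\mathcal{P}\to\mathbb{R}$ be any map and let $\rho_\varphi:A\to\mathbb{R}$ be the linear map with $\rho_\varphi(a_\lambda)=\varphi(\lambda)$ for all $\lambda$. Then: (a) $\varphi\in H(\mathcal{P})$ if and only if $\rho_\varphi(a_{\mathbf{0}})=1$ and, for all $\lambda\in\mathcal{P}$, $\rho_\varphi(a_\lambda)\ge 0$ and $\rho_\varphi(a_{\mathbf{1}}a_\lambda)=\rho_\varphi(a_\lambda)$. (b) Assume moreover that $a_{\mathbf{1}}$ commutes with every $a_\lambda$ (this is automatic when $A$ is commutative). Then $\varphi\in\partial H(\mathcal{P})$ if and only if $\rho_\varphi$ is a unital $\mathbb{R}$-algebra morphism with $\rho_\varphi(a_\lambda)\ge 0$ for all $\lambda\in\mathcal{P}$ and $\rho_\varphi(a_{\mathbf{1}})=1$. -/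

import Mathlib

open scoped NNReal

/-- A directed graph with a unique source vertex `root`, in which every vertex has finite
out-degree and every vertex is reached from `root` by a finite directed path. -/
structure RootedDigraph (V : Type*) extends Digraph V where
  root : V
  root_isSource : ∀ v, ¬ Adj v root
  unique_source : ∀ w, (∀ v, ¬ Adj v w) → w = root
  finite_out : ∀ v, {w | Adj v w}.Finite
  reachable : ∀ v, Relation.ReflTransGen Adj root v

namespace RootedDigraph

variable {V : Type*} (G : RootedDigraph V)

/-- The finite set of vertices `w` with an edge `v → w`. -/
noncomputable def succs (v : V) : Finset V := (G.finite_out v).toFinset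

@[simp] theorem mem_succs {v w : V} : w ∈ G.succs v ↔ G.Adj v w := by
  simp [succs]

/-- A harmonic function: nonnegative, with value `1` at the root, and whose value at each vertex is
the sum of its values at the out-neighbours. -/
structure IsHarmonic (φ : V → ℝ) : Prop where
  nonneg : ∀ v, 0 ≤ φ v
  root_eq_one : φ G.root = 1
  eq_sum : ∀ v, φ v = ∑ w ∈ G.succs v, φ w

/-- The set of harmonic functions. -/
def harmonic : Set (V → ℝ) := {φ | G.IsHarmonic φ}

theorem convex_harmonic : Convex ℝ G.harmonic := by
  intro φ hφ ψ hψ s t hs ht hst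
  refine ⟨fun v => ?_, ?_, fun v => ?_⟩
  · have := hφ.nonneg v
    have := hψ.nonneg v
    simp only [Pi.add_apply, Pi.smul_apply, smul_eq_mul]
    positivity
  · simp [hφ.root_eq_one, hψ.root_eq_one, hst]
  · simp only [Pi.add_apply, Pi.smul_apply, smul_eq_mul, Finset.sum_add_distrib,
      ← Finset.mul_sum, ← hφ.eq_sum v, ← hψ.eq_sum v]

end RootedDigraph

/-- The set `A₊` of all linear combinations of the basis vectors with nonnegative coefficients. -/
noncomputable def basisCone {V A : Type*} [Ring A] [Algebra ℝ A] (a : Module.Basis V ℝ A) :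
    Submodule ℝ≥0 A :=
  Submodule.span ℝ≥0 (Set.range a)

/-- A linear functional is a specialization when it is a (unital) `ℝ`-algebra morphism. -/
def IsSpecialization {A : Type*} [Ring A] [Algebra ℝ A] (ρ : A →ₗ[ℝ] ℝ) : Prop :=
  ∃ f : A →ₐ[ℝ] ℝ, f.toLinearMap = ρ

/-! Part (a) is linearity. For (b), let `φ` be extreme and fix `v`. Since `a one` commutes with `a
v`, the functional `ρ (a v * ·)` also satisfies the harmonic recursion, and on `A₊` it is dominated
by `ρ`, because `a one ^ n - a v` lies in `A₊` for some `n`. Extremality then makes it proportional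
to `ρ`, which is multiplicativity.

Conversely, extreme points are multiplicative, hence nonnegative on squares, and Krein–Milman
extends this to every harmonic functional. If a multiplicative `φ` is a mixture of `φ₁` and `φ₂`,
both must vanish on the square of `a v - φ v • 1`, which `φ` kills; a variance inequality then gives
`φ₁ v = φ v`. -/

section BasisCone

variable {V A : Type*} [Ring A] [Algebra ℝ A] {a : Module.Basis V ℝ A}

theorem basis_mem_basisCone (v : V) : a v ∈ basisCone a :=
  Submodule.subset_span ⟨v, rfl⟩

theorem nonneg_of_mem_basisCone {ρ : A →ₗ[ℝ] ℝ} (hρ : ∀ v, 0 ≤ ρ (a v)) {x : A}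
    (hx : x ∈ basisCone a) : 0 ≤ ρ x := by
  induction hx using Submodule.span_induction with
  | mem x h => obtain ⟨v, rfl⟩ := h; exact hρ v
  | zero => simp
  | add x y _ _ hx hy => rw [map_add]; exact add_nonneg hx hy
  | smul r x _ hx =>
    rw [NNReal.smul_def, map_smul, smul_eq_mul]
    exact mul_nonneg r.coe_nonneg hx

theorem basis_mul_mem_basisCone (h_pos : ∀ l m : V, a l * a m ∈ basisCone a) (v : V) {x : A}
    (hx : x ∈ basisCone a) : a v * x ∈ basisCone a := by
  induction hx using Submodule.span_induction with
  | mem x h => obtain ⟨w, rfl⟩ := h; exact h_pos v w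
  | zero => simp
  | add x y _ _ hx hy => rw [mul_add]; exact add_mem hx hy
  | smul r x _ hx => rw [mul_smul_comm]; exact Submodule.smul_mem _ r hx

theorem mul_basis_mem_basisCone (h_pos : ∀ l m : V, a l * a m ∈ basisCone a) (v : V) {x : A}
    (hx : x ∈ basisCone a) : x * a v ∈ basisCone a := by
  induction hx using Submodule.span_induction with
  | mem x h => obtain ⟨w, rfl⟩ := h; exact h_pos w v
  | zero => simp
  | add x y _ _ hx hy => rw [add_mul]; exact add_mem hx hy
  | smul r x _ hx => rw [smul_mul_assoc]; exact Submodule.smul_mem _ r hx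

end BasisCone

namespace RootedDigraph

variable {V A : Type*} [Ring A] [Algebra ℝ A] {G : RootedDigraph V} {a : Module.Basis V ℝ A}
  {one : V}

/-- Take `n` to be the length of a path from the root to `v`: `a one ^ n` is the sum of `a u` over
the endpoints `u` of all such paths, with multiplicity. -/
theorem exists_pow_sub_mem_basisCone (h_unit : a G.root = 1)
    (h_pos : ∀ l m : V, a l * a m ∈ basisCone a)
    (h_edges : ∀ l : V, a one * a l = ∑ n ∈ G.succs l, a n) (v : V) :
    ∃ n : ℕ, a one ^ n - a v ∈ basisCone a := by
  classical
  induction G.reachable v with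
  | refl => exact ⟨0, by simp [h_unit]⟩
  | @tail v w _ hvw ih =>
    obtain ⟨n, hn⟩ := ih
    refine ⟨n + 1, ?_⟩
    have hsplit : a one ^ (n + 1) - a w
        = a one * (a one ^ n - a v) + ∑ u ∈ (G.succs v).erase w, a u := by
      rw [mul_sub, ← pow_succ', h_edges, ← Finset.add_sum_erase _ _ (G.mem_succs.2 hvw)]
      abel
    rw [hsplit]
    exact add_mem (basis_mul_mem_basisCone h_pos _ hn)
      (sum_mem fun u _ => basis_mem_basisCone u)

theorem mem_harmonic_iff (h_edges : ∀ l : V, a one * a l = ∑ n ∈ G.succs l, a n)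
    {φ : V → ℝ} {ρ : A →ₗ[ℝ] ℝ} (hρ : ∀ l : V, ρ (a l) = φ l) :
    φ ∈ G.harmonic ↔
      (∀ l : V, 0 ≤ ρ (a l)) ∧ ρ (a G.root) = 1 ∧ ∀ l : V, ρ (a one * a l) = ρ (a l) := by
  simp only [h_edges, map_sum, hρ]
  exact ⟨fun h => ⟨h.nonneg, h.root_eq_one, fun l => (h.eq_sum l).symm⟩,
    fun h => ⟨h.1, h.2.1, fun l => (h.2.2 l).symm⟩⟩

theorem map_one_mul_of_mem_harmonic (h_edges : ∀ l : V, a one * a l = ∑ n ∈ G.succs l, a n)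
    {φ : V → ℝ} {ρ : A →ₗ[ℝ] ℝ} (hρ : ∀ l : V, ρ (a l) = φ l) (hφ : φ ∈ G.harmonic) (x : A) :
    ρ (a one * x) = ρ x := by
  have h : ρ ∘ₗ LinearMap.mulLeft ℝ (a one) = ρ :=
    a.ext fun l => ((mem_harmonic_iff h_edges hρ).1 hφ).2.2 l
  exact LinearMap.congr_fun h x

theorem map_one_pow_mul_of_mem_harmonic (h_edges : ∀ l : V, a one * a l = ∑ n ∈ G.succs l, a n)
    {φ : V → ℝ} {ρ : A →ₗ[ℝ] ℝ} (hρ : ∀ l : V, ρ (a l) = φ l) (hφ : φ ∈ G.harmonic) (n : ℕ)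
    (x : A) : ρ (a one ^ n * x) = ρ x := by
  induction n with
  | zero => simp
  | succ n ih =>
    rw [pow_succ', mul_assoc, map_one_mul_of_mem_harmonic h_edges hρ hφ, ih]

theorem le_one_of_mem_harmonic {φ : V → ℝ} (hφ : φ ∈ G.harmonic) (v : V) : φ v ≤ 1 := by
  induction G.reachable v with
  | refl => exact hφ.root_eq_one.le
  | @tail v w _ hvw ih =>
    refine le_trans ?_ ih
    rw [hφ.eq_sum v]
    exact Finset.single_le_sum (fun u _ => hφ.nonneg u) (G.mem_succs.2 hvw)

/-- Finite out-degree makes each harmonic equation a closed condition in the product topology. -/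
theorem isCompact_harmonic (G : RootedDigraph V) : IsCompact G.harmonic := by
  refine (isCompact_univ_pi fun _ : V => isCompact_Icc (a := (0 : ℝ)) (b := 1)).of_isClosed_subset
    ?_ fun φ hφ v _ => ⟨hφ.nonneg v, le_one_of_mem_harmonic hφ v⟩
  have h : G.harmonic = {φ | (∀ v, 0 ≤ φ v) ∧ φ G.root = 1 ∧ ∀ v, φ v = ∑ w ∈ G.succs v, φ w} :=
    Set.ext fun φ => ⟨fun h => ⟨h.nonneg, h.root_eq_one, h.eq_sum⟩, fun h => ⟨h.1, h.2.1, h.2.2⟩⟩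
  rw [h]
  simp only [Set.ofPred_and, Set.ofPred_forall]
  exact (isClosed_iInter fun v => isClosed_le (by fun_prop) (by fun_prop)).inter
    ((isClosed_eq (by fun_prop) (by fun_prop)).inter
      (isClosed_iInter fun v => isClosed_eq (by fun_prop) (by fun_prop)))

/-- An extreme harmonic function is multiplicative: perturbing `φ` by
`± (ρ (a v * ·) - φ v • φ) / 2` stays within the harmonic functions. -/
theorem map_mul_of_mem_extremePoints (h_unit : a G.root = 1)
    (h_pos : ∀ l m : V, a l * a m ∈ basisCone a)
    (h_edges : ∀ l : V, a one * a l = ∑ n ∈ G.succs l, a n)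
    (h_comm : ∀ l : V, a l * a one = a one * a l)
    {φ : V → ℝ} {ρ : A →ₗ[ℝ] ℝ} (hρ : ∀ l : V, ρ (a l) = φ l)
    (hφ : φ ∈ Set.extremePoints ℝ G.harmonic) (x y : A) : ρ (x * y) = ρ x * ρ y := by
  have hφG := hφ.1
  have hnn : ∀ v, 0 ≤ ρ (a v) := fun v => by rw [hρ]; exact hφG.nonneg v
  have hbasis : ∀ v w, ρ (a v * a w) = φ v * φ w := by
    intro v
    obtain ⟨n, hn⟩ := exists_pow_sub_mem_basisCone h_unit h_pos h_edges v
    set ψ : V → ℝ := fun w => ρ (a v * a w) - φ v * φ w with hψ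
    have hle : ∀ w, ρ (a v * a w) ≤ φ w := fun w => by
      have := nonneg_of_mem_basisCone hnn (mul_basis_mem_basisCone h_pos w hn)
      rw [sub_mul, map_sub, map_one_pow_mul_of_mem_harmonic h_edges hρ hφG, hρ] at this
      linarith
    have hψroot : ψ G.root = 0 := by
      simp [hψ, h_unit, hρ, hφG.root_eq_one]
    have hψsum : ∀ u, ψ u = ∑ w ∈ G.succs u, ψ w := fun u => by
      simp only [hψ, Finset.sum_sub_distrib, ← Finset.mul_sum, ← hφG.eq_sum u, ← map_sum,
        ← h_edges]
      -- Commutation lets `a one` pass `a v` and be absorbed by `ρ`.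
      rw [← mul_assoc, h_comm, mul_assoc, map_one_mul_of_mem_harmonic h_edges hρ hφG]
    have hperturb : ∀ c : ℝ, (∀ w, 0 ≤ φ w + c * ψ w) → (φ + c • ψ) ∈ G.harmonic := fun c hc =>
      ⟨hc, by simp [hψroot, hφG.root_eq_one], fun u => by
        simp only [Pi.add_apply, Pi.smul_apply, smul_eq_mul, Finset.sum_add_distrib,
          ← Finset.mul_sum, ← hφG.eq_sum u, ← hψsum u]⟩
    -- Nonnegativity uses `φ v ≤ 1` for the plus sign and the domination `hle` for the minus sign.
    have h₁ : φ + (1 / 2 : ℝ) • ψ ∈ G.harmonic := hperturb _ fun w => by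
      have h1 := nonneg_of_mem_basisCone hnn (h_pos v w)
      have h2 := mul_nonneg (sub_nonneg.2 (le_one_of_mem_harmonic hφG v)) (hφG.nonneg w)
      have h3 := hφG.nonneg w
      simp only [hψ]
      linarith
    have h₂ : φ + (-(1 / 2) : ℝ) • ψ ∈ G.harmonic := hperturb _ fun w => by
      have h1 := mul_nonneg (hφG.nonneg v) (hφG.nonneg w)
      have h2 := hφG.nonneg w
      have h3 := hle w
      simp only [hψ]
      linarith
    have hseg : φ ∈ openSegment ℝ (φ + (1 / 2 : ℝ) • ψ) (φ + (-(1 / 2) : ℝ) • ψ) :=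
      ⟨1 / 2, 1 / 2, by norm_num, by norm_num, by norm_num, by module⟩
    intro w
    have h := congrFun (hφ.2 h₁ h₂ hseg) w
    simp only [Pi.add_apply, Pi.smul_apply, smul_eq_mul, hψ] at h
    linarith
  have h : (LinearMap.mul ℝ A).compr₂ ρ = (LinearMap.mul ℝ ℝ).compl₁₂ ρ ρ :=
    a.ext fun v => a.ext fun w => by simp [hbasis, hρ]
  exact LinearMap.congr_fun₂ h x y

/-- Every harmonic functional is nonnegative on squares, by the Krein–Milman theorem. -/
theorem map_mul_self_nonneg_of_mem_harmonic (h_unit : a G.root = 1)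
    (h_pos : ∀ l m : V, a l * a m ∈ basisCone a)
    (h_edges : ∀ l : V, a one * a l = ∑ n ∈ G.succs l, a n)
    (h_comm : ∀ l : V, a l * a one = a one * a l)
    {φ : V → ℝ} (hφ : φ ∈ G.harmonic) (x : A) : 0 ≤ a.constr ℝ φ (x * x) := by
  have hlin : IsLinearMap ℝ fun ψ : V → ℝ => a.constr ℝ ψ (x * x) :=
    ⟨fun _ _ => by simp, fun _ _ => by simp⟩
  -- For fixed `x`, only finitely many coordinates of `ψ` enter.
  have hcont : Continuous fun ψ : V → ℝ => a.constr ℝ ψ (x * x) := by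
    simp only [Module.Basis.constr_apply, Finsupp.sum]
    fun_prop
  have hsub : closure (convexHull ℝ (Set.extremePoints ℝ G.harmonic)) ⊆
      {ψ | 0 ≤ a.constr ℝ ψ (x * x)} := by
    refine closure_minimal (convexHull_min (fun ψ hψ => ?_) (convex_halfSpace_ge hlin 0))
      (isClosed_le continuous_const hcont)
    rw [Set.mem_ofPred_eq, map_mul_of_mem_extremePoints h_unit h_pos h_edges h_comm
      (fun l => a.constr_basis ℝ ψ l) hψ]
    exact mul_self_nonneg _
  rw [closure_convexHull_extremePoints G.isCompact_harmonic G.convex_harmonic] at hsub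
  exact hsub hφ

/-- The second moment about `s` is the variance plus the squared bias; the variance is nonnegative
as the value on a square. -/
theorem sq_le_map_mul_self_of_mem_harmonic (h_unit : a G.root = 1)
    (h_pos : ∀ l m : V, a l * a m ∈ basisCone a)
    (h_edges : ∀ l : V, a one * a l = ∑ n ∈ G.succs l, a n)
    (h_comm : ∀ l : V, a l * a one = a one * a l)
    {φ : V → ℝ} (hφ : φ ∈ G.harmonic) (x : A) (s : ℝ) :
    (a.constr ℝ φ x - s) ^ 2 ≤ a.constr ℝ φ ((x - s • 1) * (x - s • 1)) := by
  have hone : a.constr ℝ φ 1 = 1 := by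
    rw [← h_unit, Module.Basis.constr_basis]; exact hφ.root_eq_one
  have hexp : ∀ r : ℝ, a.constr ℝ φ ((x - r • 1) * (x - r • 1))
      = a.constr ℝ φ (x * x) - 2 * r * a.constr ℝ φ x + r ^ 2 := fun r => by
    simp only [sub_mul, mul_sub, smul_mul_assoc, mul_smul_comm, one_mul, mul_one, map_sub,
      map_smul, smul_eq_mul, hone]
    ring
  have h := map_mul_self_nonneg_of_mem_harmonic h_unit h_pos h_edges h_comm hφ
    (x - (a.constr ℝ φ x) • 1)
  rw [hexp] at h ⊢
  linarith

theorem mem_extremePoints_of_isSpecialization (h_unit : a G.root = 1)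
    (h_pos : ∀ l m : V, a l * a m ∈ basisCone a)
    (h_edges : ∀ l : V, a one * a l = ∑ n ∈ G.succs l, a n)
    (h_comm : ∀ l : V, a l * a one = a one * a l)
    {φ : V → ℝ} (f : A →ₐ[ℝ] ℝ) (hf : ∀ l, f (a l) = φ l) (hφ : φ ∈ G.harmonic) :
    φ ∈ Set.extremePoints ℝ G.harmonic := by
  refine ⟨hφ, fun φ₁ h₁ φ₂ h₂ hseg => ?_⟩
  obtain ⟨c, d, hc, hd, -, hφeq⟩ := hseg
  have hfeq : ∀ x, f x = c * a.constr ℝ φ₁ x + d * a.constr ℝ φ₂ x := by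
    have h : f.toLinearMap = c • a.constr ℝ φ₁ + d • a.constr ℝ φ₂ :=
      a.ext fun l => by simp [hf, ← hφeq]
    exact fun x => LinearMap.congr_fun h x
  funext v
  have hq₁ := sq_le_map_mul_self_of_mem_harmonic h_unit h_pos h_edges h_comm h₁ (a v) (φ v)
  have hq₂ := sq_le_map_mul_self_of_mem_harmonic h_unit h_pos h_edges h_comm h₂ (a v) (φ v)
  -- The left side vanishes, so both nonnegative terms on the right do.
  have hzero := hfeq ((a v - φ v • 1) * (a v - φ v • 1))
  have hf0 : f (a v - φ v • 1) = 0 := by simp [hf]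
  rw [map_mul, hf0, mul_zero] at hzero
  have hle : c * (a.constr ℝ φ₁ (a v) - φ v) ^ 2 ≤ 0 := by
    have := mul_le_mul_of_nonneg_left hq₁ hc.le
    have := mul_nonneg hd.le ((sq_nonneg _).trans hq₂)
    linarith
  have hsq := pow_eq_zero_iff two_ne_zero |>.1
    (le_antisymm (nonpos_of_mul_nonpos_right hle hc) (sq_nonneg _))
  rw [Module.Basis.constr_basis] at hsq
  exact sub_eq_zero.1 hsq

end RootedDigraph

theorem mainTheorem10 {V A : Type*} [Ring A] [Algebra ℝ A] (G : RootedDigraph V)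
    (a : Module.Basis V ℝ A)
    (h_unit : a G.root = 1)
    (h_pos : ∀ l m : V, a l * a m ∈ basisCone a)
    (one : V)
    (h_edges : ∀ l : V, a one * a l = ∑ n ∈ G.succs l, a n)
    (φ : V → ℝ) (ρ : A →ₗ[ℝ] ℝ) (hρ : ∀ l : V, ρ (a l) = φ l) :
    (φ ∈ G.harmonic ↔
      (∀ l : V, 0 ≤ ρ (a l)) ∧ ρ (a G.root) = 1 ∧ ∀ l : V, ρ (a one * a l) = ρ (a l)) ∧
    ((∀ l : V, a l * a one = a one * a l) →
      (φ ∈ Set.extremePoints ℝ G.harmonic ↔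
        IsSpecialization ρ ∧ (∀ l : V, 0 ≤ ρ (a l)) ∧ ρ (a one) = 1)) := by
  refine ⟨G.mem_harmonic_iff h_edges hρ, fun h_comm => ⟨fun hφ => ?_, ?_⟩⟩
  · have hH := (G.mem_harmonic_iff h_edges hρ).1 hφ.1
    have hone : ρ 1 = 1 := h_unit ▸ hH.2.1
    refine ⟨⟨AlgHom.ofLinearMap ρ hone
      (G.map_mul_of_mem_extremePoints h_unit h_pos h_edges h_comm hρ hφ), rfl⟩, hH.1, ?_⟩
    have h := hH.2.2 G.root
    rwa [h_unit, mul_one, hone] at h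
  · rintro ⟨⟨f, rfl⟩, hnn, hone⟩
    refine G.mem_extremePoints_of_isSpecialization h_unit h_pos h_edges h_comm f hρ
      ((G.mem_harmonic_iff h_edges hρ).2 ⟨hnn, by simp [h_unit], fun l => ?_⟩)
    simp only [AlgHom.toLinearMap_apply] at hone ⊢
    rw [map_mul, hone, one_mul]
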